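/- Let $n\ge 1$, let $B=\mathbb{C}[X_1,\dots,X_n]$ be graded by giving each $X_i$ a positive integer weight $b_i$, and let $f_1,\dots,f_n\in B$ be weighted homogeneous. Put $A=\mathbb{C}[f_1,\dots,f_n]\subseteq B$ and assume that $B$ is a finitely generated $A$-module (that is, $A\subseteq B$ is a finite graded polynomial extension). For an irreducible polynomial $Q\in B$, the ideal $(Q)\cap A$ of $A$ is generated by an irreducible element $P\in A$; the ramification index $e_Q=v_Q(P)$ is the exponent of $Q$ in the factorisation of $P$ in $B$, and $Q$ is called ramified if $e_Q>1$. Let $R$ be any system of representatives, up to multiplication by nonzero scalars, of the ramified irreducible polynomials of $B$, and let $J=\det(\partial f_i/\partial X_j)_{1\le i,j\le n}$. Then $R$ is finite and, for some $c\in\mathbb{C}\setminus\{0\}$, $$J = c\prod_{Q\in R} Q^{e_Q-1}.$$ Call the extension well-ramified if $(J)\cap A=\bigl(\prod_{Q} Q^{e_Q}\bigr)$ as ideals of $A$, where $(J)=JB$, the product runs over the ramified irreducible polynomials up to nonzero scalars, and the right-hand side is the ideal of $A$ generated by the product (the equality includes that the product lies in $A$). If the extension is well-ramified, then $\prod_{Q\in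 R}Q^{e_Q}\in A$ and $$(J)\cap A=\Bigl(\prod_{Q\in R} Q^{e_Q}\Bigr)\qquad\text{as an ideal of } A.$$ By the definition of well-ramified, this second part is a tautology (up to the choice of $R$). -/

import Mathlib

/-- The subalgebra `A = ℂ[f₁, …, fₙ]` of `B = ℂ[X₁, …, Xₙ]`. -/
noncomputable abbrev extBase {n : ℕ} (f : Fin n → MvPolynomial (Fin n) ℂ) :
    Subalgebra ℂ (MvPolynomial (Fin n) ℂ) :=
  Algebra.adjoin ℂ (Set.range f)

/-- `ℂ[f₁, …, fₙ] ⊆ ℂ[X₁, …, Xₙ]` is a finite graded polynomial extension: `Xᵢ` has weight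
`b i > 0`, `fᵢ` is weighted homogeneous of weight `a i`, and `B` is a finite `A`-module. -/
structure IsFiniteGradedPolynomialExtension {n : ℕ} (b a : Fin n → ℕ)
    (f : Fin n → MvPolynomial (Fin n) ℂ) : Prop where
  weight_pos : ∀ i, 0 < b i
  homogeneous : ∀ i, MvPolynomial.IsWeightedHomogeneous b (f i) (a i)
  finite : Module.Finite (extBase f) (MvPolynomial (Fin n) ℂ)

/-- The Jacobian `J = det (∂fᵢ/∂Xⱼ)`. -/
noncomputable def extJacobian {n : ℕ} (f : Fin n → MvPolynomial (Fin n) ℂ) :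
    MvPolynomial (Fin n) ℂ :=
  Matrix.det (Matrix.of fun i j : Fin n => MvPolynomial.pderiv j (f i))

/-- The ramification index `e_Q` of the ideal `(Q)` of `B` over `(Q) ∩ A`: the largest `m` with
`((Q) ∩ A) B ⊆ (Q)ᵐ`. When `(Q) ∩ A = (P)`, this is the exponent `v_Q(P)` of `Q` in `P`
(see `extRamIdx_eq_multiplicity`). -/
noncomputable def extRamIdx {n : ℕ} (f : Fin n → MvPolynomial (Fin n) ℂ)
    (Q : MvPolynomial (Fin n) ℂ) : ℕ :=
  Ideal.ramificationIdx' ((Ideal.span {Q}).under (extBase f)) (Ideal.span {Q})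

theorem extRamIdx_eq_multiplicity {n : ℕ} (f : Fin n → MvPolynomial (Fin n) ℂ)
    (Q : MvPolynomial (Fin n) ℂ) (hQ : Irreducible Q) (P : extBase f) (hP : P ≠ 0)
    (h : (Ideal.span {Q}).under (extBase f) = Ideal.span {P}) :
    extRamIdx f Q = multiplicity Q (P : MvPolynomial (Fin n) ℂ) := by
  have hfin : FiniteMultiplicity Q (P : MvPolynomial (Fin n) ℂ) :=
    FiniteMultiplicity.of_not_isUnit hQ.not_isUnit (by simpa using hP)
  have key : ∀ m : ℕ, Ideal.map (algebraMap (extBase f) (MvPolynomial (Fin n) ℂ))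
      (Ideal.span {P}) ≤ Ideal.span {Q} ^ m ↔ Q ^ m ∣ (P : MvPolynomial (Fin n) ℂ) := by
    intro m
    rw [Ideal.map_span, Set.image_singleton, Ideal.span_singleton_pow,
      Ideal.span_singleton_le_span_singleton]
    rfl
  rw [extRamIdx, h]
  apply Ideal.ramificationIdx'_spec
  · rw [key]
    exact pow_multiplicity_dvd _ _
  · rw [key]
    exact hfin.not_pow_dvd_of_multiplicity_lt (Nat.lt_succ_self _)

/-- `Q` is an irreducible polynomial of `B` that is ramified over `A`. -/
def IsRamifiedPolynomial {n : ℕ} (f : Fin n → MvPolynomial (Fin n) ℂ)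
    (Q : MvPolynomial (Fin n) ℂ) : Prop :=
  Irreducible Q ∧ 1 < extRamIdx f Q

/-- `R` is a system of representatives, up to association, of the ramified irreducible
polynomials of `B`. -/
def IsRamifiedSystem {n : ℕ} (f : Fin n → MvPolynomial (Fin n) ℂ)
    (R : Set (MvPolynomial (Fin n) ℂ)) : Prop :=
  (∀ Q ∈ R, IsRamifiedPolynomial f Q) ∧
    ∀ Q, IsRamifiedPolynomial f Q → ∃! Q', Q' ∈ R ∧ Associated Q Q'

/-- The product `∏ Q ^ e_Q` over `R` lies in `A`, and `(J) ∩ A` is the ideal of `A` that it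
generates. -/
def JacobianContractionEq {n : ℕ} (f : Fin n → MvPolynomial (Fin n) ℂ)
    (R : Set (MvPolynomial (Fin n) ℂ)) : Prop :=
  ∃ D : extBase f, (D : MvPolynomial (Fin n) ℂ) = ∏ᶠ Q ∈ R, Q ^ extRamIdx f Q ∧
    (Ideal.span {extJacobian f}).under (extBase f) = Ideal.span {D}

/-- The extension is well-ramified: `(J) ∩ A = (∏ Q ^ e_Q)`, the product being taken over the
ramified irreducible polynomials up to association. The choice of representatives changes the
product by a nonzero scalar only. -/
def IsWellRamified {n : ℕ} (f : Fin n → MvPolynomial (Fin n) ℂ) : Prop :=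
  ∃ R, IsRamifiedSystem f R ∧ JacobianContractionEq f R

/-! Everything follows from `v_Q(J) = e_Q - 1` for every irreducible `Q`
(`emultiplicity_extJacobian`): orders at primes determine `J` up to a unit of the UFD `B`, that is,
a nonzero scalar. Let `P = p(f)` generate `(Q) ∩ A`, write `P = Q ^ e * u` with `Q ∤ u`, and choose
`k` with `Q ∤ (∂p/∂Y_k)(f)`. By the chain rule the gradient of `P` is a combination of the rows of
the Jacobian matrix; it is also `Q ^ (e - 1) * w` with `w ≡ e * u * ∇Q` mod `Q`. Replacing row `k`
gives `(∂p/∂Y_k)(f) * J = Q ^ (e - 1) * det`, where `det` is, mod `Q`, `e * u` times the Jacobian of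
`f` with `f k` replaced by `Q`. This is nonzero mod `Q`, because a derivation `B → B/(Q)` killing
the new tuple kills `A` and `(Q)`, hence vanishes by integrality. -/

theorem Derivation.eq_zero_of_isIntegral {A B : Type*} [CommRing A] [CommRing B] [Algebra A B]
    [Algebra.IsIntegral A B] (I : Ideal B) [I.IsPrime] [CharZero (B ⧸ I)]
    (D : Derivation A B (B ⧸ I)) (hD : ∀ b ∈ I, D b = 0) : D = 0 := by
  ext b
  by_contra hb
  -- If `g(b) ∈ I`, applying `D` gives `g'(b) • D b = 0`, so `g'(b) ∈ I` since `D b ≠ 0`; descend on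
  -- the degree. A monic equation for `b` then gives the contradiction.
  have key : ∀ (m : ℕ) (g : Polynomial A), g.natDegree = m → algebraMap A B g.leadingCoeff ∉ I →
      Polynomial.aeval b g ∉ I := by
    intro m
    induction m with
    | zero =>
      intro g hg hlc h
      rw [Polynomial.eq_C_of_natDegree_eq_zero hg, Polynomial.aeval_C] at h
      rw [Polynomial.leadingCoeff, hg] at hlc
      exact hlc h
    | succ m ih =>
      intro g hg hlc h
      have hc : algebraMap A B (g.derivative.coeff m) ∉ I := by
        rw [Polynomial.coeff_derivative, map_mul, ← hg]
        intro hmem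
        rcases Ideal.IsPrime.mem_or_mem ‹_› hmem with h1 | h1
        · exact hlc (by rwa [Polynomial.leadingCoeff, hg] at *)
        · have h2 : ((m + 1 : ℕ) : B ⧸ I) = 0 := by
            rw [← Ideal.Quotient.eq_zero_iff_mem] at h1
            simpa using h1
          exact absurd h2 (Nat.cast_ne_zero.2 m.succ_ne_zero)
      have hdeg : g.derivative.natDegree = m := by
        apply le_antisymm
        · have := Polynomial.natDegree_derivative_le g
          omega
        · apply Polynomial.le_natDegree_of_ne_zero
          intro h0
          apply hc
          rw [h0, map_zero]
          exact I.zero_mem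
      have h3 : Polynomial.aeval b g.derivative ∉ I := by
        apply ih _ hdeg
        rwa [Polynomial.leadingCoeff, hdeg]
      have h4 := hD _ h
      rw [Derivation.map_aeval, Algebra.smul_def, mul_eq_zero] at h4
      rcases h4 with h4 | h4
      · exact h3 (Ideal.Quotient.eq_zero_iff_mem.1 h4)
      · exact hb h4
  obtain ⟨g, hg, hgb⟩ := Algebra.IsIntegral.isIntegral (R := A) b
  refine key _ g rfl ?_ ?_
  · rw [hg.leadingCoeff, map_one]
    exact (Ideal.ne_top_iff_one I).1 (Ideal.IsPrime.ne_top ‹_›)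
  · rw [Polynomial.aeval_def, hgb]
    exact I.zero_mem

/-! ### Derivations and Jacobians of polynomial rings -/

namespace MvPolynomial

theorem derivation_aeval {σ k B M : Type*} [Fintype σ] [CommRing k] [CommRing B] [Algebra k B]
    [AddCommGroup M] [Module k M] [Module B M] (D : Derivation k B M)
    (f : σ → B) (p : MvPolynomial σ k) :
    D (aeval f p) = ∑ i, aeval f (pderiv i p) • D (f i) := by
  classical
  induction p using MvPolynomial.induction_on with
  | C r => simp
  | add p q hp hq => simp [hp, hq, add_smul, Finset.sum_add_distrib]
  | mul_X p i hp =>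
    simp only [map_mul, aeval_X, Derivation.leibniz, hp, pderiv_X, smul_eq_mul, map_add, add_smul,
      Finset.sum_add_distrib, Finset.smul_sum, Pi.single_apply, smul_smul]
    congr 1
    rw [Finset.sum_eq_single i] <;> simp +contextual [eq_comm]

theorem derivation_eq_sum_pderiv {σ k M : Type*} [Fintype σ] [CommRing k]
    [AddCommGroup M] [Module k M] [Module (MvPolynomial σ k) M]
    (D : Derivation k (MvPolynomial σ k) M) (p : MvPolynomial σ k) :
    D p = ∑ i, pderiv i p • D (X i) := by
  simpa using derivation_aeval D X p

/-- A nonzero kernel vector of the matrix over the domain `B/I`, taken as values on the variables,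
defines a nonzero derivation killing every `g i`. -/
theorem det_pderiv_notMem {σ k : Type*} [Fintype σ] [DecidableEq σ] [Field k]
    (I : Ideal (MvPolynomial σ k)) [I.IsPrime] (g : σ → MvPolynomial σ k)
    (h : ∀ D : Derivation k (MvPolynomial σ k) (MvPolynomial σ k ⧸ I),
      (∀ i, D (g i) = 0) → D = 0) :
    Matrix.det (Matrix.of fun i j => pderiv j (g i)) ∉ I := by
  intro hdet
  rw [← Ideal.Quotient.eq_zero_iff_mem, RingHom.map_det] at hdet
  obtain ⟨v, hv, hv0⟩ := Matrix.exists_mulVec_eq_zero_iff.2 hdet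
  have hD := h (mkDerivation k v) fun i => by
    rw [derivation_eq_sum_pderiv]
    simp only [mkDerivation_X]
    exact congrFun hv0 i
  apply hv
  ext i
  rw [← mkDerivation_X k v i, hD]
  rfl

/-- Differentiation lowers the total degree, so divisibility forces all partials to vanish; in
characteristic zero `p` is then constant. -/
theorem exists_not_dvd_pderiv {σ k : Type*} [Field k] [CharZero k]
    (p : MvPolynomial σ k) (hp : Irreducible p) : ∃ i, ¬ p ∣ pderiv i p := by
  classical
  by_contra! h
  have hz : ∀ i, pderiv i p = 0 := by
    intro i
    by_contra hne
    obtain ⟨q, hq⟩ := h i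
    have hq0 : q ≠ 0 := by
      rintro rfl
      exact hne (by rw [hq, mul_zero])
    have h1 : (pderiv i p).totalDegree = p.totalDegree + q.totalDegree := by
      rw [hq, totalDegree_mul_of_isDomain hp.ne_zero hq0]
    obtain ⟨m, hm, hmd⟩ : ∃ m ∈ (pderiv i p).support,
        (m.sum fun _ e => e) = (pderiv i p).totalDegree := by
      obtain ⟨m, hm, h⟩ := Finset.exists_mem_eq_sup (pderiv i p).support (support_nonempty.2 hne)
        fun m => m.sum fun _ e => e
      exact ⟨m, hm, h.symm⟩
    rw [mem_support_iff, coeff_pderiv] at hm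
    have h2 := le_totalDegree (mem_support_iff.2 (left_ne_zero_of_mul hm))
    rw [Finsupp.sum_add_index' (by simp) (by simp), Finsupp.sum_single_index rfl] at h2
    omega
  apply hp.not_isUnit
  have hC : p = C (coeff 0 p) := by
    ext m
    rw [coeff_C]
    split_ifs with hm
    · rw [hm]
    · obtain ⟨i, hi⟩ : ∃ i, m i ≠ 0 := by
        by_contra! h0
        exact hm (Finsupp.ext h0).symm
      have := congrArg (coeff (m - Finsupp.single i 1)) (hz i)
      rw [coeff_pderiv, tsub_add_cancel_of_le (by
        rw [Finsupp.single_le_iff]; omega), coeff_zero, mul_eq_zero] at this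
      refine this.resolve_right ?_
      exact Nat.cast_add_one_ne_zero _
  rw [hC]
  refine (isUnit_iff_ne_zero.2 fun h0 => ?_).map C
  rw [h0, C_0] at hC
  exact hp.ne_zero hC

end MvPolynomial

/-! ### Contraction of principal primes -/

theorem Ideal.exists_prime_under_span_singleton {A B : Type*} [CommRing A] [IsDomain A]
    [UniqueFactorizationMonoid A] [CommRing B] [IsDomain B] [UniqueFactorizationMonoid B]
    [Algebra A B] [FaithfulSMul A B] [Algebra.IsIntegral A B] {Q : B} (hQ : Prime Q) :
    ∃ P : A, Prime P ∧ (Ideal.span {Q}).under A = Ideal.span {P} := by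
  have hQp : (Ideal.span {Q}).IsPrime := (Ideal.span_singleton_prime hQ.ne_zero).2 hQ
  have hne : (Ideal.span {Q}).under A ≠ ⊥ :=
    Ideal.IsIntegral.comap_ne_bot A (by simpa using hQ.ne_zero)
  obtain ⟨P, hP, hPp⟩ := Ideal.IsPrime.exists_mem_prime_of_ne_bot
    (inferInstance : ((Ideal.span {Q}).under A).IsPrime) hne
  have hPp' : (Ideal.span {P}).IsPrime := (Ideal.span_singleton_prime hPp.ne_zero).2 hPp
  refine ⟨P, hPp, ?_⟩
  -- Going down: a nonzero prime `I` inside the height-one prime `(Q)` must equal it, so `(Q)`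
  -- itself lies over `(P)`.
  obtain ⟨I, hIle, hI, hIP⟩ := Ideal.exists_ideal_le_liesOver_of_le (p := Ideal.span {P})
    (q := (Ideal.span {Q}).under A) (Ideal.span {Q}) (by simpa [Ideal.span_le] using hP)
  have hIne : I ≠ ⊥ := by
    rintro rfl
    have := hIP.over
    rw [Ideal.under_bot, Ideal.span_singleton_eq_bot] at this
    exact hPp.ne_zero this
  obtain ⟨q, hqI, hq⟩ := hI.exists_mem_prime_of_ne_bot hIne
  have hass : Associated Q q :=
    hQ.associated_of_dvd hq (Ideal.mem_span_singleton.1 (hIle hqI))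
  have hIQ : I = Ideal.span {Q} := by
    refine le_antisymm hIle ?_
    rw [Ideal.span_singleton_eq_span_singleton.2 hass, Ideal.span_singleton_le_iff_mem]
    exact hqI
  rw [← hIQ, ← hIP.over]

/-! ### Order of the Jacobian along an irreducible polynomial -/

section

variable {n : ℕ} (f : Fin n → MvPolynomial (Fin n) ℂ)
  [Module.Finite (extBase f) (MvPolynomial (Fin n) ℂ)]

/-- `B` has transcendence degree `n` and is algebraic over the subalgebra generated by these `n`
elements. -/
theorem algebraicIndependent_of_finite_extBase : AlgebraicIndependent ℂ f := by
  refine (Algebra.IsAlgebraic.isTranscendenceBasis_of_le_trdeg_of_finite ℂ f ?_).1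
  simp

theorem exists_irreducible_under_span_eq {Q : MvPolynomial (Fin n) ℂ} (hQ : Irreducible Q) :
    ∃ p : MvPolynomial (Fin n) ℂ, Irreducible p ∧ ∃ P : extBase f,
      (P : MvPolynomial (Fin n) ℂ) = MvPolynomial.aeval f p ∧
      (Ideal.span {Q}).under (extBase f) = Ideal.span {P} ∧
      ∀ q, Q ∣ MvPolynomial.aeval f q ↔ p ∣ q := by
  let e := (algebraicIndependent_of_finite_extBase f).aevalEquiv
  have : UniqueFactorizationMonoid (extBase f) :=
    e.toMulEquiv.uniqueFactorizationMonoid inferInstance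
  obtain ⟨P, hP, h⟩ := Ideal.exists_prime_under_span_singleton (A := extBase f) hQ.prime
  have he : ∀ q, ((e q : extBase f) : MvPolynomial (Fin n) ℂ) = MvPolynomial.aeval f q :=
    fun _ => rfl
  refine ⟨e.symm P, (MulEquiv.irreducible_iff e.symm.toMulEquiv).2 hP.irreducible, P, ?_, h, ?_⟩
  · rw [← he, e.apply_symm_apply]
  · intro q
    have h1 : e q ∈ (Ideal.span {Q}).under (extBase f) ↔ Q ∣ MvPolynomial.aeval f q := by
      rw [Ideal.mem_comap, Ideal.mem_span_singleton]
      rfl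
    rw [← h1, h, Ideal.mem_span_singleton, ← map_dvd_iff e.symm, e.symm_apply_apply]

theorem derivation_quotient_eq_zero (I : Ideal (MvPolynomial (Fin n) ℂ)) [I.IsPrime]
    (D : Derivation ℂ (MvPolynomial (Fin n) ℂ) (MvPolynomial (Fin n) ℂ ⧸ I))
    (hf : ∀ i, D (f i) = 0) (hI : ∀ b ∈ I, D b = 0) : D = 0 := by
  have hA : ∀ a : extBase f, D a = 0 := by
    intro a
    have := Derivation.eqOn_adjoin (D1 := D) (D2 := 0) (s := Set.range f)
      (by rintro _ ⟨i, rfl⟩; exact hf i)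
    exact this a.2
  have : CharZero (MvPolynomial (Fin n) ℂ ⧸ I) := algebraRat.charZero _
  let D' : Derivation (extBase f) (MvPolynomial (Fin n) ℂ) (MvPolynomial (Fin n) ℂ ⧸ I) :=
    Derivation.mk'
      { toFun := D
        map_add' := map_add D
        map_smul' := fun a b => by
          rw [Algebra.smul_def, Derivation.leibniz]
          erw [hA a]
          rw [smul_zero, add_zero]
          rfl }
      (fun a b => D.leibniz a b)
  have := Derivation.eq_zero_of_isIntegral I D' hI
  ext1 i
  exact congrArg (fun E => E (MvPolynomial.X i)) this

theorem extJacobian_ne_zero : extJacobian f ≠ 0 := by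
  have := MvPolynomial.det_pderiv_notMem (⊥ : Ideal (MvPolynomial (Fin n) ℂ)) f fun D hD =>
    derivation_quotient_eq_zero f ⊥ D hD (by simp +contextual)
  rwa [Ideal.mem_bot] at this

theorem emultiplicity_extJacobian {Q : MvPolynomial (Fin n) ℂ} (hQ : Irreducible Q) :
    emultiplicity Q (extJacobian f) = (extRamIdx f Q - 1 : ℕ) := by
  classical
  obtain ⟨p, hp, P, hPp, hP, hdvd⟩ := exists_irreducible_under_span_eq f hQ
  have hP0 : P ≠ 0 := by
    rintro rfl
    rw [ZeroMemClass.coe_zero, eq_comm, map_eq_zero_iff _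
      (algebraicIndependent_of_finite_extBase f)] at hPp
    exact hp.ne_zero hPp
  have hI : (Ideal.span {Q}).IsPrime := (Ideal.span_singleton_prime hQ.ne_zero).2 hQ.prime
  obtain ⟨k, hk⟩ := MvPolynomial.exists_not_dvd_pderiv p hp
  rw [← hdvd] at hk
  have hfm : FiniteMultiplicity Q (P : MvPolynomial (Fin n) ℂ) :=
    FiniteMultiplicity.of_not_isUnit hQ.not_isUnit (by simpa using hP0)
  obtain ⟨u, hu, hQu⟩ := hfm.exists_eq_pow_mul_and_not_dvd
  rw [← extRamIdx_eq_multiplicity f Q hQ P hP0 hP] at hu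
  have hQP : Q ∣ (P : MvPolynomial (Fin n) ℂ) := by
    rw [hPp, hdvd]
  -- `Q ∣ P` gives `e_Q ≥ 1`, so the truncated subtraction is harmless.
  obtain ⟨m, hm⟩ : ∃ m, extRamIdx f Q = m + 1 := by
    refine Nat.exists_eq_succ_of_ne_zero fun h0 => hQu ?_
    rwa [hu, h0, pow_zero, one_mul] at hQP
  rw [hm] at hu ⊢
  let M : Matrix (Fin n) (Fin n) (MvPolynomial (Fin n) ℂ) :=
    Matrix.of fun i j => MvPolynomial.pderiv j (f i)
  -- The row of partial derivatives of `P`, divided by `Q ^ m`.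
  let w : Fin n → MvPolynomial (Fin n) ℂ := fun j =>
    ((m + 1 : ℕ) * u) * MvPolynomial.pderiv j Q + Q * MvPolynomial.pderiv j u
  have hrow : ∑ i, MvPolynomial.aeval f (MvPolynomial.pderiv i p) • M i = Q ^ m • w := by
    ext1 j
    have h1 := MvPolynomial.derivation_aeval (MvPolynomial.pderiv j) f p
    rw [← hPp, hu, Derivation.leibniz, Derivation.leibniz_pow] at h1
    simp only [Finset.sum_apply, Pi.smul_apply, M, Matrix.of_apply]
    rw [← h1]
    simp only [w, smul_eq_mul, nsmul_eq_mul, Nat.add_sub_cancel]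
    ring
  have hdet : MvPolynomial.aeval f (MvPolynomial.pderiv k p) * extJacobian f =
      Q ^ m * (M.updateRow k w).det := by
    have := Matrix.det_updateRow_sum M k fun i => MvPolynomial.aeval f (MvPolynomial.pderiv i p)
    rw [hrow, Matrix.det_updateRow_smul, smul_eq_mul] at this
    exact this.symm
  have hnd : ¬ Q ∣ (M.updateRow k w).det := by
    let g := Function.update f k Q
    have hg : (Matrix.of fun i j => MvPolynomial.pderiv j (g i)) =
        M.updateRow k fun j => MvPolynomial.pderiv j Q := by
      ext1 i j
      by_cases h : i = k
      · subst h
        simp [g]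
      · simp [g, h, M]
    have hw : w = ((m + 1 : ℕ) * u) • (fun j => MvPolynomial.pderiv j Q) +
        Q • (fun j => MvPolynomial.pderiv j u) := rfl
    rw [hw, Matrix.det_updateRow_add, Matrix.det_updateRow_smul, Matrix.det_updateRow_smul,
      ← hg, dvd_add_left (dvd_mul_right _ _), hQ.prime.dvd_mul,
      hQ.prime.dvd_mul]
    rintro ((h | h) | h)
    · refine hQ.not_isUnit (isUnit_of_dvd_unit h ?_)
      have : IsUnit ((m + 1 : ℕ) : ℂ) := isUnit_iff_ne_zero.2 (Nat.cast_ne_zero.2 m.succ_ne_zero)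
      simpa using this.map (algebraMap ℂ (MvPolynomial (Fin n) ℂ))
    · exact hQu h
    · rw [← Ideal.mem_span_singleton] at h
      refine MvPolynomial.det_pderiv_notMem _ g (fun D hD => ?_) h
      have hDQ : D Q = 0 := by simpa [g] using hD k
      have hDI : ∀ b ∈ Ideal.span {Q}, D b = 0 := by
        intro b hb
        obtain ⟨c, rfl⟩ := Ideal.mem_span_singleton.1 hb
        rw [Derivation.leibniz, hDQ, smul_zero, add_zero, Algebra.smul_def,
          Ideal.Quotient.algebraMap_eq, Ideal.Quotient.eq_zero_iff_mem.2
          (Ideal.mem_span_singleton_self Q), zero_mul]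
      have hDf : ∀ i, i ≠ k → D (f i) = 0 := fun i hi => by simpa [g, hi] using hD i
      refine derivation_quotient_eq_zero f _ D (fun i => ?_) hDI
      by_cases hi : i = k
      · subst hi
        -- Since `P ∈ (Q)`, `D P = 0`; the chain rule leaves only the term of index `k`, whose
        -- coefficient is nonzero mod `Q`.
        have h1 := MvPolynomial.derivation_aeval D f p
        rw [← hPp, hDI _ (Ideal.mem_span_singleton.2 hQP), Finset.sum_eq_single i
          (fun j _ hj => by rw [hDf j hj, smul_zero]) (by simp), Algebra.smul_def, eq_comm,
          mul_eq_zero, Ideal.Quotient.algebraMap_eq, Ideal.Quotient.eq_zero_iff_mem,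
          Ideal.mem_span_singleton] at h1
        exact h1.resolve_left hk
      · exact hDf i hi
  have hk0 := emultiplicity_eq_zero.2 hk
  have hnd0 := emultiplicity_eq_zero.2 hnd
  have := congrArg (emultiplicity Q) hdet
  rwa [emultiplicity_mul hQ.prime, emultiplicity_mul hQ.prime, hk0, hnd0, zero_add, add_zero,
    emultiplicity_pow_self hQ.ne_zero hQ.not_isUnit] at this

end

/-! ### Products over systems of representatives -/

theorem associated_of_forall_emultiplicity_eq {B : Type*} [CommRing B] [IsDomain B]
    [UniqueFactorizationMonoid B] {x y : B} (hx : x ≠ 0) (hy : y ≠ 0)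
    (h : ∀ p : B, Prime p → emultiplicity p x = emultiplicity p y) : Associated x y :=
  associated_of_dvd_dvd
    ((UniqueFactorizationMonoid.dvd_iff_emultiplicity_le hx).2 fun p hp => (h p hp).le)
    ((UniqueFactorizationMonoid.dvd_iff_emultiplicity_le hy).2 fun p hp => (h p hp).ge)

theorem emultiplicity_finprod_pow_eq_zero {B : Type*} [CommRing B] [IsDomain B] {R : Set B}
    (hfin : R.Finite) (g : B → ℕ) (hirr : ∀ q ∈ R, Irreducible q) {p : B} (hp : Prime p)
    (hR : ∀ q ∈ R, ¬ Associated p q) : emultiplicity p (∏ᶠ q ∈ R, q ^ g q) = 0 := by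
  rw [finprod_mem_eq_finite_toFinset_prod _ hfin, Finset.emultiplicity_prod hp]
  refine Finset.sum_eq_zero fun q hq => ?_
  rw [Set.Finite.mem_toFinset] at hq
  rw [emultiplicity_eq_zero]
  intro h
  exact hR q hq (hp.irreducible.associated_of_dvd (hirr q hq) (hp.dvd_of_dvd_pow h))

theorem emultiplicity_finprod_pow {B : Type*} [CommRing B] [IsDomain B] {R : Set B}
    (hfin : R.Finite) (g : B → ℕ) (hirr : ∀ q ∈ R, Irreducible q) {p q : B} (hp : Prime p)
    (hq : q ∈ R) (hpq : Associated p q) (huniq : ∀ r ∈ R, Associated p r → r = q) :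
    emultiplicity p (∏ᶠ q ∈ R, q ^ g q) = g q := by
  rw [finprod_mem_eq_finite_toFinset_prod _ hfin, Finset.emultiplicity_prod hp,
    Finset.sum_eq_single q]
  · rw [emultiplicity_eq_of_associated_left hpq.symm, emultiplicity_pow_self (hirr q hq).ne_zero
      (hirr q hq).not_isUnit]
  · intro r hr hrq
    rw [Set.Finite.mem_toFinset] at hr
    rw [emultiplicity_eq_zero]
    intro h
    exact hrq (huniq r hr
      (hp.irreducible.associated_of_dvd (hirr r hr) (hp.dvd_of_dvd_pow h)))
  · simp [hq]

theorem finprod_mem_pow_ne_zero {B : Type*} [CommRing B] [IsDomain B] {R : Set B}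
    (g : B → ℕ) (hirr : ∀ q ∈ R, Irreducible q) : ∏ᶠ q ∈ R, q ^ g q ≠ 0 :=
  finprod_mem_induction (· ≠ 0) one_ne_zero (fun _ _ => mul_ne_zero)
    fun q hq => pow_ne_zero _ (hirr q hq).ne_zero

section

variable {n : ℕ} {f : Fin n → MvPolynomial (Fin n) ℂ}

theorem extRamIdx_eq_of_associated {Q Q' : MvPolynomial (Fin n) ℂ} (h : Associated Q Q') :
    extRamIdx f Q = extRamIdx f Q' := by
  rw [extRamIdx, extRamIdx, Ideal.span_singleton_eq_span_singleton.2 h]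

theorem IsRamifiedPolynomial.of_associated {Q Q' : MvPolynomial (Fin n) ℂ}
    (hQ : IsRamifiedPolynomial f Q) (h : Associated Q' Q) : IsRamifiedPolynomial f Q' :=
  ⟨h.irreducible_iff.2 hQ.1, by rw [extRamIdx_eq_of_associated h]; exact hQ.2⟩

namespace IsRamifiedSystem

variable {R R' : Set (MvPolynomial (Fin n) ℂ)}

/-- The function `g` serves both exponents needed, `e_Q - 1` and `e_Q`. -/
theorem emultiplicity_finprod_of_isRamifiedPolynomial (hR : IsRamifiedSystem f R)
    (hfin : R.Finite) (g : ℕ → ℕ) {Q : MvPolynomial (Fin n) ℂ} (hQ : IsRamifiedPolynomial f Q) :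
    emultiplicity Q (∏ᶠ Q ∈ R, Q ^ g (extRamIdx f Q)) = g (extRamIdx f Q) := by
  obtain ⟨Q', ⟨hQ', hass⟩, huniq⟩ := hR.2 Q hQ
  rw [emultiplicity_finprod_pow hfin (fun Q => g (extRamIdx f Q)) (fun q hq => (hR.1 q hq).1)
    hQ.1.prime hQ' hass fun r hr h => huniq r ⟨hr, h⟩, extRamIdx_eq_of_associated hass]

theorem emultiplicity_finprod_of_not_isRamifiedPolynomial (hR : IsRamifiedSystem f R)
    (hfin : R.Finite) (g : ℕ → ℕ) {Q : MvPolynomial (Fin n) ℂ} (hQ : Prime Q)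
    (hQr : ¬ IsRamifiedPolynomial f Q) :
    emultiplicity Q (∏ᶠ Q ∈ R, Q ^ g (extRamIdx f Q)) = 0 :=
  emultiplicity_finprod_pow_eq_zero hfin (fun Q => g (extRamIdx f Q)) (fun q hq => (hR.1 q hq).1)
    hQ fun q hq h => hQr ((hR.1 q hq).of_associated h)

theorem finprod_ne_zero (hR : IsRamifiedSystem f R) (g : ℕ → ℕ) :
    ∏ᶠ Q ∈ R, Q ^ g (extRamIdx f Q) ≠ 0 :=
  finprod_mem_pow_ne_zero (fun Q => g (extRamIdx f Q)) fun q hq => (hR.1 q hq).1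

theorem associated_finprod (hR : IsRamifiedSystem f R) (hR' : IsRamifiedSystem f R')
    (hfin : R.Finite) (hfin' : R'.Finite) (g : ℕ → ℕ) :
    Associated (∏ᶠ Q ∈ R, Q ^ g (extRamIdx f Q)) (∏ᶠ Q ∈ R', Q ^ g (extRamIdx f Q)) := by
  refine associated_of_forall_emultiplicity_eq (hR.finprod_ne_zero g) (hR'.finprod_ne_zero g)
    fun p hp => ?_
  by_cases hpr : IsRamifiedPolynomial f p
  · rw [hR.emultiplicity_finprod_of_isRamifiedPolynomial hfin g hpr,
      hR'.emultiplicity_finprod_of_isRamifiedPolynomial hfin' g hpr]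
  · rw [hR.emultiplicity_finprod_of_not_isRamifiedPolynomial hfin g hp hpr,
      hR'.emultiplicity_finprod_of_not_isRamifiedPolynomial hfin' g hp hpr]

variable [Module.Finite (extBase f) (MvPolynomial (Fin n) ℂ)]

/-- Ramified `Q` divide `J ≠ 0`, and distinct members of `R` are not associated, so `R` injects into
the factors of `J`. -/
theorem finite (hR : IsRamifiedSystem f R) : R.Finite := by
  classical
  have hdvd : ∀ Q ∈ R, Q ∣ extJacobian f := by
    intro Q hQ
    rw [← emultiplicity_ne_zero, emultiplicity_extJacobian f (hR.1 Q hQ).1]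
    have := (hR.1 Q hQ).2
    exact Nat.cast_ne_zero.2 (by omega)
  choose! q hq hass using fun Q hQ => UniqueFactorizationMonoid.exists_mem_factors_of_dvd
    (extJacobian_ne_zero f) (hR.1 Q hQ).1 (hdvd Q hQ)
  refine Set.Finite.of_injOn (f := q)
    (t := (UniqueFactorizationMonoid.factors (extJacobian f)).toFinset) ?_ ?_
    (Finset.finite_toSet _)
  · intro Q hQ
    simpa using hq Q hQ
  · intro Q hQ Q' hQ' h
    refine (hR.2 Q (hR.1 Q hQ)).unique ⟨hQ, Associated.refl Q⟩ ⟨hQ', ?_⟩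
    refine (hass Q hQ).trans ?_
    rw [h]
    exact (hass Q' hQ').symm

theorem associated_extJacobian (hR : IsRamifiedSystem f R) :
    Associated (∏ᶠ Q ∈ R, Q ^ (extRamIdx f Q - 1)) (extJacobian f) := by
  refine associated_of_forall_emultiplicity_eq (hR.finprod_ne_zero (· - 1)) (extJacobian_ne_zero f)
    fun p hp => ?_
  rw [emultiplicity_extJacobian f hp.irreducible]
  by_cases hpr : IsRamifiedPolynomial f p
  · exact hR.emultiplicity_finprod_of_isRamifiedPolynomial hR.finite (· - 1) hpr
  · have h1 : extRamIdx f p - 1 = 0 := by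
      have : ¬ 1 < extRamIdx f p := fun h => hpr ⟨hp.irreducible, h⟩
      omega
    rw [h1, Nat.cast_zero]
    exact hR.emultiplicity_finprod_of_not_isRamifiedPolynomial hR.finite (· - 1) hp hpr

end IsRamifiedSystem

end

theorem MvPolynomial.exists_C_mul_eq_of_associated {σ k : Type*} [Field k]
    {x y : MvPolynomial σ k} (h : Associated x y) : ∃ c : k, c ≠ 0 ∧ y = C c * x := by
  obtain ⟨u, rfl⟩ := h
  obtain ⟨c, hc, hu⟩ := MvPolynomial.isUnit_iff_eq_C_of_isReduced.1 u.isUnit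
  exact ⟨c, hc.ne_zero, by rw [hu, mul_comm]⟩

theorem mainTheorem1 (n : ℕ) (hn : 0 < n) (b a : Fin n → ℕ)
    (f : Fin n → MvPolynomial (Fin n) ℂ)
    (hf : IsFiniteGradedPolynomialExtension b a f)
    (R : Set (MvPolynomial (Fin n) ℂ)) (hR : IsRamifiedSystem f R) :
    R.Finite ∧
    (∃ c : ℂ, c ≠ 0 ∧
      extJacobian f = MvPolynomial.C c * ∏ᶠ Q ∈ R, Q ^ (extRamIdx f Q - 1)) ∧
    (IsWellRamified f →
      ∃ D : Algebra.adjoin ℂ (Set.range f),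
        (D : MvPolynomial (Fin n) ℂ) = ∏ᶠ Q ∈ R, Q ^ extRamIdx f Q ∧
        (Ideal.span {extJacobian f}).under (Algebra.adjoin ℂ (Set.range f)) =
          Ideal.span {D}) := by
  have := hf.finite
  refine ⟨hR.finite, MvPolynomial.exists_C_mul_eq_of_associated hR.associated_extJacobian, ?_⟩
  -- The system `R'` may differ from `R`; the two products differ by a nonzero scalar, a unit of
  -- `A`, so the ideal is the same.
  rintro ⟨R', hR', D, hD, hJ⟩
  obtain ⟨c, hc, h⟩ := MvPolynomial.exists_C_mul_eq_of_associated
    (hR'.associated_finprod hR hR'.finite hR.finite id)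
  refine ⟨algebraMap ℂ _ c * D, ?_, ?_⟩
  · simp only [id_eq] at h
    rw [h, ← hD]
    rfl
  · rw [hJ, Ideal.span_singleton_mul_left_unit ((isUnit_iff_ne_zero.2 hc).map _)]
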